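/- \textbf{Setting.} Let $\mathcal F$ be a finite signature, partitioned into defined symbols $\mathcal D$ and constructors $\mathcal C$, and let $\mathcal V$ be a set of variables. \emph{Values} are the terms built from variables and constructors; \emph{basic terms} are variables and terms $f(v_1,\dots,v_n)$ with $f\in\mathcal D$ and all $v_i$ values. The depth of a variable is $1$, and $\mathrm{dp}(f(t_1,\dots,t_n))=1+\max_i \mathrm{dp}(t_i)$, with $\max\varnothing=0$. A \emph{TRS} is a set of rules $l\to r$ such that $l$ is not a variable and all variables of $r$ occur in $l$; it is a \emph{constructor TRS} if all left-hand sides are basic. A term is a normal form of $\mathcal R$ if no $\mathcal R$-rewrite step applies to it. An innermost step $s\xrightarrow{\,i\,}_{\mathcal R}t$ is a rewrite step that contracts a redex all of whose arguments are normal forms of $\mathcal R$, and $\mathrm{dh}(s,\xrightarrow{\,i\,}_{\mathcal R})$ is the supremum of the lengths of innermost derivations starting in $s$. A \emph{precedence} is a preorder $\succcurlyeq$ on $\mathcal F$, with strict part $\succ$ and induced equivalence $\approx$. It is \emph{admissible} if $f\approx g$ implies that $f,g$ are both defined or both constructors, and no constructor $c$ satisfies $c\succ f$ for a defined symbol $f$.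 A \emph{safe mapping} assigns to every symbol a set of safe argument positions, which for constructors is the set of all positions; the other positions are normal. We write $f(s_1,\dots,s_k;s_{k+1},\dots,s_{k+l})$ with the normal arguments before the semicolon and the safe ones behind it. \emph{Safe equivalence} $\sim$ is defined inductively: $s\sim t$ if $s=t$, or $s=f(s_1,\dots,s_n)$, $t=g(t_1,\dots,t_n)$, $f\approx g$, and there is a permutation $\pi$ such that, for all $i$, $s_i\sim t_{\pi(i)}$ and $i$ is safe for $f$ iff $\pi(i)$ is safe for $g$. For $s=f(s_1,\dots,s_k;s_{k+1},\dots,s_{k+l})$, the auxiliary order $s\sqsupset t$ holds if (1) $s_i\sqsupset t$ or $s_i\sim t$ for some $i$, where $i$ has to be normal if $f\in\mathcal D$; or (2) $f\in\mathcal D$, $t=g(t_1,\dots,t_p)$, $f\succ g$ and $s\sqsupset t_j$ for all $j$. Let $\mathcal T_{\prec s}$ be the set of terms built from variables and from function symbols that are strictly below ($\prec$) some function symbol occurring in $s$. The order $>$ ($\mathrm{POP}^*_{\mathrm{PS}}$) is defined inductively: $s=f(s_1,\dots,s_k;s_{k+1},\dots,s_{k+l})>t$ if one of the following holds: 1. $s_i>t$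 or $s_i\sim t$ for some $i$; 2. $f\in\mathcal D$, $t=g(t_1,\dots,t_m;t_{m+1},\dots,t_{m+n})$, $f\succ g$; $s\sqsupset t_j$ for all normal positions $j$; $s>t_j$ for all safe positions $j$; and $t_j\notin\mathcal T_{\prec s}$ for at most one safe position $j$; 3. $f\in\mathcal D$, $t=g(t_1,\dots,t_m;t_{m+1},\dots,t_{m+n})$, $f\approx g$; $\{\!\{s_1,\dots,s_k\}\!\}$ is greater than $\{\!\{t_1,\dots,t_m\}\!\}$ in the strict multiset extension of $>$ modulo $\sim$; and $s>t_j$ and $t_j\in\mathcal T_{\prec s}$ for all safe positions $j$. Here $M$ is greater than $N$ in the strict multiset extension of $>$ modulo $\sim$ if $M=Z\uplus X$ and $N=W\uplus Y$, where $X\neq\varnothing$, the elements of $Z$ and $W$ can be matched bijectively into $\sim$-related pairs, and every $y\in Y$ has some $x\in X$ with $x>y$. A TRS $\mathcal R$ is \emph{predicative recursive (with parameter substitution)} with respect to an admissible precedence and a safe mapping if it is a constructor TRS and $l>r$ for every rule $l\to r$ of $\mathcal R$. \textbf{Theorem.} Let $\mathcal R$ be a finite set of pairs of terms over $\mathcal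 F$ and $\mathcal V$. There is a polynomial $p$ with natural number coefficients, depending only on $\mathcal R$ and $\mathcal F$, such that for every admissible precedence and every safe mapping with respect to which $\mathcal R$ is a predicative recursive TRS (with parameter substitution), and for every basic term $f(u_1,\dots,u_k;v_1,\dots,v_l)$ with $f\in\mathcal D$, $$\mathrm{dh}\bigl(f(u_1,\dots,u_k;v_1,\dots,v_l),\xrightarrow{\,i\,}_{\mathcal R}\bigr)\le p\bigl(\max_{1\le i\le k}\mathrm{dp}(u_i)\bigr),$$ where the maximum is $0$ if $f$ has no normal argument positions. In particular all these derivation heights are finite. -/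

import Mathlib

namespace POPStarPS

universe u v

/-- A signature: function symbols with arities, partitioned into defined symbols and
constructors (the symbols that are not defined). -/
structure Signature where
  Sym : Type u
  ar : Sym → ℕ
  IsDefined : Sym → Prop

/-- First-order terms over the signature `S` and the variables `V`. -/
inductive Term (S : Signature.{u}) (V : Type v) : Type (max u v)
  | var (x : V) : Term S V
  | app (f : S.Sym) (args : Fin (S.ar f) → Term S V) : Term S V

namespace Term

variable {S : Signature.{u}} {V : Type v}

/-- Application of a substitution. -/
def subst (σ : V → Term S V) : Term S V → Term S V
  | var x => σ x
  | app f a => app f fun i => (a i).subst σ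

/-- The set of variables of a term. -/
def vars : Term S V → Set V
  | var x => {x}
  | app _ a => ⋃ i, (a i).vars

/-- The set `Fun(t)` of function symbols occurring in a term. -/
def syms : Term S V → Set S.Sym
  | var _ => ∅
  | app f a => insert f (⋃ i, (a i).syms)

/-- The depth: `1` for variables and `1 + max` of the depths of the arguments otherwise,
where the maximum of the empty set is `0`. -/
def depth : Term S V → ℕ
  | var _ => 1
  | app _ a => 1 + Finset.univ.sup fun i => (a i).depth

/-- Values: terms built from variables and constructors. -/
inductive IsValue : Term S V → Prop
  | var (x : V) : IsValue (Term.var x)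
  | app (c : S.Sym) (a : Fin (S.ar c) → Term S V) (hc : ¬ S.IsDefined c)
      (ha : ∀ i, IsValue (a i)) : IsValue (Term.app c a)

/-- Basic terms: variables, and defined symbols applied to values. -/
inductive IsBasic : Term S V → Prop
  | var (x : V) : IsBasic (Term.var x)
  | app (f : S.Sym) (a : Fin (S.ar f) → Term S V) (hf : S.IsDefined f)
      (ha : ∀ i, (a i).IsValue) : IsBasic (Term.app f a)

end Term

section Rewriting

variable {S : Signature.{u}} {V : Type v}

/-- Every pair in `R` is a rewrite rule: the left-hand side is not a variable and the variables
of the right-hand side occur in the left-hand side. -/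
def IsTRS (R : Set (Term S V × Term S V)) : Prop :=
  ∀ l r, (l, r) ∈ R → (∀ x, l ≠ Term.var x) ∧ r.vars ⊆ l.vars

/-- All left-hand sides are basic terms. -/
def IsConstructorTRS (R : Set (Term S V × Term S V)) : Prop :=
  ∀ l r, (l, r) ∈ R → l.IsBasic

/-- The rewrite relation: the closure of `R` under substitutions and contexts. -/
inductive Step (R : Set (Term S V × Term S V)) : Term S V → Term S V → Prop
  | root {l r : Term S V} (h : (l, r) ∈ R) (σ : V → Term S V) :
      Step R (l.subst σ) (r.subst σ)
  | ctx (f : S.Sym) (a : Fin (S.ar f) → Term S V) (i : Fin (S.ar f)) {t : Term S V}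
      (h : Step R (a i) t) : Step R (Term.app f a) (Term.app f (Function.update a i t))

/-- Normal forms of `R`. -/
def IsNormalForm (R : Set (Term S V × Term S V)) (s : Term S V) : Prop :=
  ∀ t, ¬ Step R s t

/-- The innermost rewrite relation: all arguments of the contracted redex are normal forms. -/
inductive InnermostStep (R : Set (Term S V × Term S V)) : Term S V → Term S V → Prop
  | root {l r : Term S V} (h : (l, r) ∈ R) (σ : V → Term S V)
      (f : S.Sym) (a : Fin (S.ar f) → Term S V) (hl : l.subst σ = Term.app f a)
      (ha : ∀ i, IsNormalForm R (a i)) :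
      InnermostStep R (Term.app f a) (r.subst σ)
  | ctx (f : S.Sym) (a : Fin (S.ar f) → Term S V) (i : Fin (S.ar f)) {t : Term S V}
      (h : InnermostStep R (a i) t) :
      InnermostStep R (Term.app f a) (Term.app f (Function.update a i t))

/-- `Steps R n s t`: there is an innermost derivation of length `n` from `s` to `t`. -/
inductive Steps (R : Set (Term S V × Term S V)) : ℕ → Term S V → Term S V → Prop
  | refl (s : Term S V) : Steps R 0 s s
  | cons {n : ℕ} {s t w : Term S V} (h : InnermostStep R s t) (hs : Steps R n t w) :
      Steps R (n + 1) s w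

/-- The innermost derivation height: the supremum, in the extended natural numbers, of the
lengths of the innermost derivations that start in `s`. -/
noncomputable def derivationHeight (R : Set (Term S V × Term S V)) (s : Term S V) : ℕ∞ :=
  sSup {n : ℕ∞ | ∃ (k : ℕ) (t : Term S V), Steps R k s t ∧ n = (k : ℕ∞)}

end Rewriting

/-- The strict multiset extension of `eqv ∪ gt`, with multisets compared modulo `eqv`: `N` is
obtained from `M` by replacing a nonempty part `X` by a multiset `Y` of elements each of which
is dominated by an element of `X`, and the rest `Z` by a multiset `W` with the same
`eqv`-classes. -/
def MulExt {α : Type*} (eqv gt : α → α → Prop) (M N : Multiset α) : Prop :=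
  ∃ X Y Z W : Multiset α, X ≠ 0 ∧ M = Z + X ∧ N = W + Y ∧ Multiset.Rel eqv Z W ∧
    ∀ y ∈ Y, ∃ x ∈ X, gt x y

theorem MulExt.mono {α : Type*} {eqv gt gt' : α → α → Prop} (h : ∀ a b, gt a b → gt' a b)
    {M N : Multiset α} (hM : MulExt eqv gt M N) : MulExt eqv gt' M N := by
  obtain ⟨X, Y, Z, W, hX, h1, h2, h3, h4⟩ := hM
  refine ⟨X, Y, Z, W, hX, h1, h2, h3, fun y hy => ?_⟩
  obtain ⟨x, hx, hxy⟩ := h4 y hy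
  exact ⟨x, hx, h x y hxy⟩

/-- A (quasi-)precedence: a preorder on the function symbols. -/
structure Precedence (S : Signature.{u}) where
  ge : S.Sym → S.Sym → Prop
  refl : ∀ f, ge f f
  trans : ∀ f g h, ge f g → ge g h → ge f h

namespace Precedence

variable {S : Signature.{u}} (P : Precedence S)

/-- The induced proper order. -/
def gt (f g : S.Sym) : Prop := P.ge f g ∧ ¬ P.ge g f

/-- The induced equivalence. -/
def eqv (f g : S.Sym) : Prop := P.ge f g ∧ P.ge g f

/-- Admissible precedences: equivalent symbols are both defined or both constructors, and no
constructor is strictly above a defined symbol. -/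
structure Admissible : Prop where
  defined_iff : ∀ f g, P.eqv f g → (S.IsDefined f ↔ S.IsDefined g)
  constructor_not_gt : ∀ c f, ¬ S.IsDefined c → S.IsDefined f → ¬ P.gt c f

end Precedence

/-- A safe mapping: the set of safe argument positions of each symbol, which is the set of all
positions in the case of constructors. The other positions are normal. -/
structure SafeMapping (S : Signature.{u}) where
  safe : ∀ f : S.Sym, Finset (Fin (S.ar f))
  safe_constructor : ∀ c, ¬ S.IsDefined c → safe c = Finset.univ

section Orders

variable {S : Signature.{u}} {V : Type v}

/-- The multiset of the arguments at normal positions. -/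
def SafeMapping.normalArgs (μ : SafeMapping S) (f : S.Sym) (a : Fin (S.ar f) → Term S V) :
    Multiset (Term S V) :=
  (Finset.univ.filter fun i => i ∉ μ.safe f).val.map a

/-- The maximal depth of the arguments at normal positions (`0` if there are none). -/
def SafeMapping.maxNormalDepth (μ : SafeMapping S) (f : S.Sym)
    (a : Fin (S.ar f) → Term S V) : ℕ :=
  (Finset.univ.filter fun i => i ∉ μ.safe f).sup fun i => (a i).depth

variable (P : Precedence S) (μ : SafeMapping S)

/-- Safe equivalence of terms. The bijection `π` of the argument positions forces the two
arities to be equal. -/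
inductive SafeEqv : Term S V → Term S V → Prop
  | refl (s : Term S V) : SafeEqv s s
  | app (f g : S.Sym) (a : Fin (S.ar f) → Term S V) (b : Fin (S.ar g) → Term S V)
      (hfg : P.eqv f g) (π : Fin (S.ar f) ≃ Fin (S.ar g))
      (hπ : ∀ i, i ∈ μ.safe f ↔ π i ∈ μ.safe g)
      (h : ∀ i, SafeEqv (a i) (b (π i))) :
      SafeEqv (Term.app f a) (Term.app g b)

/-- The auxiliary order. The clause for subterms is split according to whether the argument
is equivalent to `t` or above `t`. -/
inductive AuxGt : Term S V → Term S V → Prop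
  | st_eqv (f : S.Sym) (a : Fin (S.ar f) → Term S V) (t : Term S V) (i : Fin (S.ar f))
      (hi : S.IsDefined f → i ∉ μ.safe f) (h : SafeEqv P μ (a i) t) :
      AuxGt (Term.app f a) t
  | st_gt (f : S.Sym) (a : Fin (S.ar f) → Term S V) (t : Term S V) (i : Fin (S.ar f))
      (hi : S.IsDefined f → i ∉ μ.safe f) (h : AuxGt (a i) t) :
      AuxGt (Term.app f a) t
  | ia (f g : S.Sym) (a : Fin (S.ar f) → Term S V) (b : Fin (S.ar g) → Term S V)
      (hf : S.IsDefined f) (hfg : P.gt f g) (h : ∀ j, AuxGt (Term.app f a) (b j)) :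
      AuxGt (Term.app f a) (Term.app g b)

/-- `t` is built from variables and from symbols that are strictly below some symbol
occurring in `s`. -/
def BelowFun (s t : Term S V) : Prop :=
  ∀ g ∈ t.syms, ∃ f ∈ s.syms, P.gt f g

/-- The polynomial path order with parameter substitution. In the last clause `gt` is any part
of the order being defined; as `MulExt` is monotone this says that the multisets of normal
arguments are related by the multiset extension of the order itself, see `gtPS_iff`. -/
inductive GtPS : Term S V → Term S V → Prop
  | st_eqv (f : S.Sym) (a : Fin (S.ar f) → Term S V) (t : Term S V) (i : Fin (S.ar f))
      (h : SafeEqv P μ (a i) t) :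
      GtPS (Term.app f a) t
  | st_gt (f : S.Sym) (a : Fin (S.ar f) → Term S V) (t : Term S V) (i : Fin (S.ar f))
      (h : GtPS (a i) t) :
      GtPS (Term.app f a) t
  | ia (f g : S.Sym) (a : Fin (S.ar f) → Term S V) (b : Fin (S.ar g) → Term S V)
      (hf : S.IsDefined f) (hfg : P.gt f g)
      (hnormal : ∀ j, j ∉ μ.safe g → AuxGt P μ (Term.app f a) (b j))
      (hsafe : ∀ j, j ∈ μ.safe g → GtPS (Term.app f a) (b j))
      (hone : ∀ j k, j ∈ μ.safe g → k ∈ μ.safe g → ¬ BelowFun P (Term.app f a) (b j) →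
        ¬ BelowFun P (Term.app f a) (b k) → j = k) :
      GtPS (Term.app f a) (Term.app g b)
  | ep (f g : S.Sym) (a : Fin (S.ar f) → Term S V) (b : Fin (S.ar g) → Term S V)
      (hf : S.IsDefined f) (hfg : P.eqv f g)
      (gt : Term S V → Term S V → Prop) (hgt : ∀ s t, gt s t → GtPS s t)
      (hmul : MulExt (SafeEqv P μ) gt (μ.normalArgs f a) (μ.normalArgs g b))
      (hsafe : ∀ j, j ∈ μ.safe g → GtPS (Term.app f a) (b j))
      (hbelow : ∀ j, j ∈ μ.safe g → BelowFun P (Term.app f a) (b j)) :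
      GtPS (Term.app f a) (Term.app g b)

/-- The three defining clauses of the order. -/
theorem gtPS_iff (f : S.Sym) (a : Fin (S.ar f) → Term S V) (t : Term S V) :
    GtPS P μ (Term.app f a) t ↔
      (∃ i, GtPS P μ (a i) t ∨ SafeEqv P μ (a i) t) ∨
      (S.IsDefined f ∧ ∃ (g : S.Sym) (b : Fin (S.ar g) → Term S V), t = Term.app g b ∧
        P.gt f g ∧
        (∀ j, j ∉ μ.safe g → AuxGt P μ (Term.app f a) (b j)) ∧
        (∀ j, j ∈ μ.safe g → GtPS P μ (Term.app f a) (b j)) ∧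
        (∀ j k, j ∈ μ.safe g → k ∈ μ.safe g → ¬ BelowFun P (Term.app f a) (b j) →
          ¬ BelowFun P (Term.app f a) (b k) → j = k)) ∨
      (S.IsDefined f ∧ ∃ (g : S.Sym) (b : Fin (S.ar g) → Term S V), t = Term.app g b ∧
        P.eqv f g ∧
        MulExt (SafeEqv P μ) (GtPS P μ) (μ.normalArgs f a) (μ.normalArgs g b) ∧
        (∀ j, j ∈ μ.safe g →
          GtPS P μ (Term.app f a) (b j) ∧ BelowFun P (Term.app f a) (b j))) := by
  constructor
  · intro h
    cases h with
    | st_eqv _ _ _ i h => exact Or.inl ⟨i, Or.inr h⟩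
    | st_gt _ _ _ i h => exact Or.inl ⟨i, Or.inl h⟩
    | ia _ g _ b hf hfg h1 h2 h3 => exact Or.inr (Or.inl ⟨hf, g, b, rfl, hfg, h1, h2, h3⟩)
    | ep _ g _ b hf hfg gt hgt h1 h2 h3 =>
      exact Or.inr (Or.inr ⟨hf, g, b, rfl, hfg, h1.mono hgt, fun j hj => ⟨h2 j hj, h3 j hj⟩⟩)
  · rintro (⟨i, h | h⟩ | ⟨hf, g, b, rfl, hfg, h1, h2, h3⟩ | ⟨hf, g, b, rfl, hfg, h1, h2⟩)
    · exact .st_gt f a t i h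
    · exact .st_eqv f a t i h
    · exact .ia f g a b hf hfg h1 h2 h3
    · exact .ep f g a b hf hfg (GtPS P μ) (fun _ _ h => h) h1 (fun j hj => (h2 j hj).1)
        (fun j hj => (h2 j hj).2)

/-- `R` is predicative recursive with parameter substitution, witnessed by the precedence `P`
and the safe mapping `μ`: `R` is a constructor TRS, `P` is admissible, and every rule is
oriented by the induced order. -/
structure PredicativeRecursivePS (R : Set (Term S V × Term S V)) : Prop where
  isTRS : IsTRS R
  isConstructorTRS : IsConstructorTRS R
  admissible : P.Admissible
  compatible : ∀ l r, (l, r) ∈ R → GtPS P μ l r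

end Orders

end POPStarPS

/-!
The proof bounds, for every symbol `g` and all normal forms `c`, both the length of the innermost
derivations from `g(c)` and the depth of the normal forms they reach (`SymbolBound`): with `m` and
`d` the maximal depths of the arguments at normal and at safe positions, the length is at most
`T(m)` and the depth at most `Q(m) + d` for polynomials `T` and `Q`. As in predicative recursion,
the safe arguments do not influence the length at all, and influence the depth only additively.

Arguments are normal forms rather than values, since an irreducible term may contain defined
symbols.

The polynomials are found by induction along the precedence. Suppose that the symbols strictly
below `f` are bounded, and that `l → r` with root `f` of `l` is applied with substitution `σ`.
The subterms of `r` are evaluated by cases on how they are related to `l`.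
* A term that is equivalent to, or below, an argument of `l` becomes a normal form whose depth is
  at most that of the argument (`GtPS.subst_of_isValue`, `AuxGt.subst_of_isValue`).
* A term below `l` in the auxiliary order has a bound in `m` only (`exists_bound_of_auxGt`). Such
  terms stand at the normal positions of symbols below `f`, so that the polynomials of these
  symbols are never applied to `d`.
* A term without recursive call has a bound `p(m)` for the length and `q(m) + d` for the depth
  (`exists_bound_of_belowFun`).
* Any other term contains at most one recursive call, since only one safe argument may contain
  any, and the bounds for this call enter additively (`exists_bound_of_gtPS`).

In a recursive call the multiset of the depths of the normal arguments decreases in the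
Dershowitz–Manna order, without an increase of `m`. Only polynomially many multisets of bounded
size have entries up to `m`, so the number of smaller ones is a rank that bounds the number of
nested recursive calls by a polynomial in `m` (`multisetRank`, `exists_symbolBound_of_lower`).

There are finitely many precedences and safe mappings on a finite signature; the sum of the
polynomials obtained for each of them serves all of them.
-/

namespace POPStarPS

universe u v

/-! ### Monotonicity of polynomials with natural coefficients -/

theorem monotone_polynomial_eval (p : Polynomial ℕ) : Monotone fun m => p.eval m := by
  intro m n h
  simp only [Polynomial.eval_eq_sum_range]
  exact Finset.sum_le_sum fun i _ => Nat.mul_le_mul_left _ (Nat.pow_le_pow_left h i)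

/-! ### Depth -/

variable {S : Signature.{u}} {V : Type v}

namespace Term

theorem depth_arg_lt (f : S.Sym) (a : Fin (S.ar f) → Term S V) (i : Fin (S.ar f)) :
    (a i).depth < (app f a).depth := by
  have h := Finset.le_sup (f := fun i => (a i).depth) (Finset.mem_univ i)
  simp only [depth] at h ⊢
  omega

theorem IsValue.not_isDefined {s : Term S V} (hs : s.IsValue) :
    ∀ g ∈ s.syms, ¬ S.IsDefined g := by
  induction hs with
  | var x => simp [syms]
  | app c a hc _ ih =>
    intro g hg
    simp only [syms, Set.mem_insert_iff, Set.mem_iUnion] at hg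
    obtain rfl | ⟨i, hi⟩ := hg
    · exact hc
    · exact ih i g hi

end Term

/-- The maximal depth of the arguments at safe positions (`0` if there are none). -/
def SafeMapping.maxSafeDepth (μ : SafeMapping S) (f : S.Sym)
    (a : Fin (S.ar f) → Term S V) : ℕ :=
  (Finset.univ.filter fun i => i ∈ μ.safe f).sup fun i => (a i).depth

namespace SafeMapping

variable (μ : SafeMapping S) {f : S.Sym} {a : Fin (S.ar f) → Term S V}

theorem depth_le_maxNormalDepth {i : Fin (S.ar f)} (hi : i ∉ μ.safe f) :
    (a i).depth ≤ μ.maxNormalDepth f a :=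
  Finset.le_sup (f := fun i => (a i).depth) (by simpa using hi)

theorem depth_le_maxSafeDepth {i : Fin (S.ar f)} (hi : i ∈ μ.safe f) :
    (a i).depth ≤ μ.maxSafeDepth f a :=
  Finset.le_sup (f := fun i => (a i).depth) (by simpa using hi)

theorem depth_arg_le (i : Fin (S.ar f)) :
    (a i).depth ≤ μ.maxNormalDepth f a + μ.maxSafeDepth f a := by
  by_cases hi : i ∈ μ.safe f
  · exact (μ.depth_le_maxSafeDepth hi).trans (Nat.le_add_left _ _)
  · exact (μ.depth_le_maxNormalDepth hi).trans (Nat.le_add_right _ _)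

theorem depth_app_le :
    (Term.app f a).depth ≤ 1 + (μ.maxNormalDepth f a + μ.maxSafeDepth f a) :=
  Nat.add_le_add_left (Finset.sup_le fun i _ => μ.depth_arg_le i) 1

theorem maxNormalDepth_le {n : ℕ} (h : ∀ i, i ∉ μ.safe f → (a i).depth ≤ n) :
    μ.maxNormalDepth f a ≤ n :=
  Finset.sup_le fun i hi => h i (by simpa using hi)

theorem maxSafeDepth_le {n : ℕ} (h : ∀ i, i ∈ μ.safe f → (a i).depth ≤ n) :
    μ.maxSafeDepth f a ≤ n :=
  Finset.sup_le fun i hi => h i (by simpa using hi)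

end SafeMapping

/-! ### Bounded evaluation -/

/-- Every innermost derivation from `t` has length at most `n`, and every normal form at the end
of such a derivation satisfies `φ`. -/
def EvaluatesWithin (R : Set (Term S V × Term S V)) (n : ℕ) (φ : Term S V → Prop)
    (t : Term S V) : Prop :=
  ∀ k t', Steps R k t t' → k ≤ n ∧ (IsNormalForm R t' → φ t')

section Evaluation

variable {R : Set (Term S V × Term S V)}

theorem InnermostStep.step {s t : Term S V} (h : InnermostStep R s t) : Step R s t := by
  induction h with
  | root h σ f a hl _ => exact hl ▸ Step.root h σ
  | ctx f a i _ ih => exact Step.ctx f a i ih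

theorem IsNormalForm.arg {f : S.Sym} {a : Fin (S.ar f) → Term S V}
    (h : IsNormalForm R (Term.app f a)) (i : Fin (S.ar f)) : IsNormalForm R (a i) :=
  fun _ ht => h _ (.ctx f a i ht)

theorem evaluatesWithin_iff {n : ℕ} {φ : Term S V → Prop} {t : Term S V} :
    EvaluatesWithin R n φ t ↔ (IsNormalForm R t → φ t) ∧
      ∀ t', InnermostStep R t t' → ∃ n' < n, EvaluatesWithin R n' φ t' := by
  constructor
  · intro h
    refine ⟨(h 0 t (.refl t)).2, fun t' ht => ⟨n - 1, ?_, fun k w hw => ?_⟩⟩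
    · have := (h 1 t' (.cons ht (.refl t'))).1
      omega
    · have := h (k + 1) w (.cons ht hw)
      exact ⟨by omega, this.2⟩
  · rintro ⟨h1, h2⟩ k t' hk
    cases hk with
    | refl => exact ⟨Nat.zero_le _, h1⟩
    | cons h hs =>
      obtain ⟨n', hn, h'⟩ := h2 _ h
      have := h' _ _ hs
      exact ⟨by omega, this.2⟩

namespace EvaluatesWithin

theorem mono {n n' : ℕ} {φ ψ : Term S V → Prop} {t : Term S V}
    (h : EvaluatesWithin R n φ t) (hn : n ≤ n') (hφ : ∀ s, φ s → ψ s) :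
    EvaluatesWithin R n' ψ t :=
  fun k t' hk => ⟨(h k t' hk).1.trans hn, fun hnf => hφ _ ((h k t' hk).2 hnf)⟩

theorem of_isNormalForm {n : ℕ} {φ : Term S V → Prop} {t : Term S V}
    (ht : IsNormalForm R t) (hφ : φ t) : EvaluatesWithin R n φ t :=
  evaluatesWithin_iff.2 ⟨fun _ => hφ, fun _ h => absurd h.step (ht _)⟩

/-- An innermost derivation from an application evaluates the arguments before it contracts the
root, so that the bounds for the arguments add up. -/
theorem app {g : S.Sym} {N : ℕ} {ψ : Term S V → Prop} {φ : Fin (S.ar g) → Term S V → Prop}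
    (hroot : ∀ c : Fin (S.ar g) → Term S V, (∀ i, IsNormalForm R (c i)) → (∀ i, φ i (c i)) →
      EvaluatesWithin R N ψ (Term.app g c))
    {n : Fin (S.ar g) → ℕ} {b : Fin (S.ar g) → Term S V}
    (harg : ∀ i, EvaluatesWithin R (n i) (φ i) (b i)) :
    EvaluatesWithin R (∑ i, n i + N) ψ (Term.app g b) := by
  induction hs : ∑ i, n i using Nat.strong_induction_on generalizing n b with
  | _ s ih =>
    have hnf : (∀ i, IsNormalForm R (b i)) → EvaluatesWithin R N ψ (Term.app g b) := fun h =>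
      hroot b h fun i => (evaluatesWithin_iff.1 (harg i)).1 (h i)
    refine evaluatesWithin_iff.2
      ⟨fun h => (evaluatesWithin_iff.1 (hnf h.arg)).1 h, fun t' ht => ?_⟩
    cases ht with
    | root h σ _ _ hl ha =>
      obtain ⟨n', hn', h'⟩ := (evaluatesWithin_iff.1 (hnf ha)).2 _ (.root h σ g b hl ha)
      exact ⟨n', by omega, h'⟩
    | ctx _ _ i h =>
      obtain ⟨n', hn', h'⟩ := (evaluatesWithin_iff.1 (harg i)).2 _ h
      have hlt : ∑ j, Function.update n i n' j < s := by
        rw [← hs]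
        refine Finset.sum_lt_sum (fun j _ => ?_) ⟨i, Finset.mem_univ i, by simpa using hn'⟩
        by_cases hj : j = i
        · subst hj; simpa using hn'.le
        · simp [hj]
      refine ⟨_, Nat.add_lt_add_right hlt N, ih _ hlt (fun j => ?_) rfl⟩
      by_cases hj : j = i
      · subst hj; simpa using h'
      · simpa [hj] using harg j

end EvaluatesWithin

variable (R) in
/-- The evaluation of `g` on normal forms: the number of steps is bounded by `T` in the maximal
depth of the normal arguments alone, and the depth of the results by `Q` in this depth, plus the
maximal depth of the safe arguments. -/
def SymbolBound (μ : SafeMapping S) (T Q : Polynomial ℕ) (g : S.Sym) : Prop :=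
  ∀ c : Fin (S.ar g) → Term S V, (∀ i, IsNormalForm R (c i)) →
    EvaluatesWithin R (T.eval (μ.maxNormalDepth g c))
      (fun t => t.depth ≤ Q.eval (μ.maxNormalDepth g c) + μ.maxSafeDepth g c) (Term.app g c)

theorem SymbolBound.evaluatesWithin_app {μ : SafeMapping S} {T Q : Polynomial ℕ} {g : S.Sym}
    (hg : SymbolBound R μ T Q g) {A B : ℕ} {n : Fin (S.ar g) → ℕ} {b : Fin (S.ar g) → Term S V}
    (hnormal : ∀ i, i ∉ μ.safe g → EvaluatesWithin R (n i) (fun t => t.depth ≤ A) (b i))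
    (hsafe : ∀ i, i ∈ μ.safe g → EvaluatesWithin R (n i) (fun t => t.depth ≤ B) (b i)) :
    EvaluatesWithin R (∑ i, n i + T.eval A) (fun t => t.depth ≤ Q.eval A + B)
      (Term.app g b) := by
  refine EvaluatesWithin.app
    (φ := fun i t => t.depth ≤ if i ∈ μ.safe g then B else A) (fun c hc hφ => ?_) fun i => ?_
  · have hA : μ.maxNormalDepth g c ≤ A := μ.maxNormalDepth_le fun i hi => by
      simpa [hi] using hφ i
    have hB : μ.maxSafeDepth g c ≤ B := μ.maxSafeDepth_le fun i hi => by
      simpa [hi] using hφ i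
    exact (hg c hc).mono (monotone_polynomial_eval T hA) fun t ht =>
      ht.trans (Nat.add_le_add (monotone_polynomial_eval Q hA) hB)
  · by_cases hi : i ∈ μ.safe g
    · simpa [hi] using hsafe i hi
    · simpa [hi] using hnormal i hi

end Evaluation

/-! ### Values below patterns -/

section Orders

variable {R : Set (Term S V × Term S V)} {P : Precedence S} {μ : SafeMapping S}

theorem PredicativeRecursivePS.exists_lhs (h : PredicativeRecursivePS P μ R)
    {l r : Term S V} (hlr : (l, r) ∈ R) :
    ∃ (f : S.Sym) (a : Fin (S.ar f) → Term S V), l = Term.app f a ∧ S.IsDefined f ∧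
      ∀ i, (a i).IsValue := by
  cases h.isConstructorTRS l r hlr with
  | var x => exact absurd rfl ((h.isTRS _ r hlr).1 x)
  | app f a hf ha => exact ⟨f, a, rfl, hf, ha⟩

theorem PredicativeRecursivePS.isNormalForm_app (h : PredicativeRecursivePS P μ R)
    {c : S.Sym} (hc : ¬ S.IsDefined c) {a : Fin (S.ar c) → Term S V}
    (ha : ∀ i, IsNormalForm R (a i)) : IsNormalForm R (Term.app c a) := by
  intro t ht
  generalize hs : Term.app c a = s at ht
  cases ht with
  | root hlr σ =>
    obtain ⟨f, b, rfl, hf, -⟩ := h.exists_lhs hlr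
    simp only [Term.subst] at hs
    cases hs
    exact hc hf
  | ctx f b i hi =>
    cases hs
    exact ha i _ hi

theorem PredicativeRecursivePS.isNormalForm_of_isValue (h : PredicativeRecursivePS P μ R)
    {s : Term S V} (hs : s.IsValue) : IsNormalForm R s := by
  induction hs with
  | var x =>
    intro t ht
    generalize hs : Term.var x = s at ht
    cases ht with
    | root hlr σ =>
      obtain ⟨f, b, rfl, -⟩ := h.exists_lhs hlr
      simp [Term.subst] at hs
    | ctx => cases hs
  | app c a hc _ ih => exact h.isNormalForm_app hc ih

theorem depth_app_eq_of_equiv {f g : S.Sym} {a : Fin (S.ar f) → Term S V}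
    {b : Fin (S.ar g) → Term S V} (π : Fin (S.ar f) ≃ Fin (S.ar g))
    (h : ∀ i, (b (π i)).depth = (a i).depth) :
    (Term.app g b).depth = (Term.app f a).depth := by
  simp only [Term.depth]
  congr 1
  apply le_antisymm
  · refine Finset.sup_le fun j _ => ?_
    obtain ⟨i, rfl⟩ := π.surjective j
    rw [h i]
    exact Finset.le_sup (f := fun i => (a i).depth) (Finset.mem_univ i)
  · refine Finset.sup_le fun i _ => ?_
    rw [← h i]
    exact Finset.le_sup (f := fun i => (b i).depth) (Finset.mem_univ (π i))

/-- A term equivalent to a value contains constructors only; so its instances are normal forms as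
soon as those of the value are. -/
theorem SafeEqv.subst_of_isValue (h : PredicativeRecursivePS P μ R) (σ : V → Term S V)
    {s t : Term S V} (hst : SafeEqv P μ s t) (hs : s.IsValue)
    (hnf : IsNormalForm R (s.subst σ)) :
    IsNormalForm R (t.subst σ) ∧ (t.subst σ).depth = (s.subst σ).depth := by
  induction hst with
  | refl s => exact ⟨hnf, rfl⟩
  | app f g a b hfg π _ _ ih =>
    cases hs with
    | app _ _ hf ha =>
      have ih' := fun i => ih i (ha i) (hnf.arg i)
      simp only [Term.subst]
      refine ⟨h.isNormalForm_app (mt (h.admissible.defined_iff f g hfg).2 hf) fun j => ?_,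
        depth_app_eq_of_equiv π fun i => (ih' i).2⟩
      obtain ⟨i, rfl⟩ := π.surjective j
      exact (ih' i).1

theorem GtPS.subst_of_isValue (h : PredicativeRecursivePS P μ R) (σ : V → Term S V)
    {s t : Term S V} (hst : GtPS P μ s t) (hs : s.IsValue)
    (hnf : IsNormalForm R (s.subst σ)) :
    IsNormalForm R (t.subst σ) ∧ (t.subst σ).depth < (s.subst σ).depth := by
  induction hs generalizing t with
  | var x => cases hst
  | app f a hf ha ih =>
    have hlt := fun i => Term.depth_arg_lt f (fun i => (a i).subst σ) i
    rcases (gtPS_iff P μ f a t).1 hst with ⟨i, hi | hi⟩ | h' | h'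
    · exact (ih i hi (hnf.arg i)).imp_right fun h => h.trans (hlt i)
    · exact (hi.subst_of_isValue h σ (ha i) (hnf.arg i)).imp_right fun h => h.trans_lt (hlt i)
    · exact absurd h'.1 hf
    · exact absurd h'.1 hf

theorem AuxGt.subst_of_isValue (h : PredicativeRecursivePS P μ R) (σ : V → Term S V)
    {s t : Term S V} (hst : AuxGt P μ s t) (hs : s.IsValue)
    (hnf : IsNormalForm R (s.subst σ)) :
    IsNormalForm R (t.subst σ) ∧ (t.subst σ).depth < (s.subst σ).depth := by
  induction hs generalizing t with
  | var x => cases hst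
  | app f a hf ha ih =>
    have hlt := fun i => Term.depth_arg_lt f (fun i => (a i).subst σ) i
    cases hst with
    | st_eqv _ _ _ i _ hi =>
      exact (hi.subst_of_isValue h σ (ha i) (hnf.arg i)).imp_right fun h => h.trans_lt (hlt i)
    | st_gt _ _ _ i _ hi => exact (ih i hi (hnf.arg i)).imp_right fun h => h.trans (hlt i)
    | ia _ _ _ _ hf' => exact absurd hf' hf

end Orders

/-! ### Ranks of multisets of depths -/

section Rank

open Classical in
/-- All multisets of at most `K` natural numbers that are at most `m`. -/
noncomputable def boundedMultisets (K m : ℕ) : Finset (Multiset ℕ) :=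
  (Finset.range (K + 1)).biUnion fun k =>
    (Fintype.piFinset fun _ : Fin k => Finset.range (m + 1)).image fun g =>
      Finset.univ.val.map g

theorem mem_boundedMultisets {K m : ℕ} {M : Multiset ℕ} (hK : M.card ≤ K)
    (hm : ∀ x ∈ M, x ≤ m) : M ∈ boundedMultisets K m := by
  obtain ⟨l, rfl⟩ := M.exists_rep
  simp only [Multiset.quot_mk_to_coe, Multiset.coe_card,
    Multiset.mem_coe] at hK hm ⊢
  simp only [boundedMultisets, Finset.mem_biUnion, Finset.mem_range, Finset.mem_image,
    Fintype.mem_piFinset]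
  refine ⟨l.length, by omega, l.get, fun i => Nat.lt_succ_of_le (hm _ (l.get_mem i)), ?_⟩
  rw [Fin.univ_val_map, List.ofFn_get]

theorem card_boundedMultisets_le (K m : ℕ) :
    (boundedMultisets K m).card ≤ ∑ k ∈ Finset.range (K + 1), (m + 1) ^ k := by
  refine Finset.card_biUnion_le.trans (Finset.sum_le_sum fun k _ => ?_)
  exact Finset.card_image_le.trans (by simp)

open Classical in
/-- The number of bounded multisets below `M` in the Dershowitz–Manna order. -/
noncomputable def multisetRank (K m : ℕ) (M : Multiset ℕ) : ℕ :=
  ((boundedMultisets K m).filter fun N => N.IsDershowitzMannaLT M).card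

theorem multisetRank_lt {K m : ℕ} {M N : Multiset ℕ} (hN : N ∈ boundedMultisets K m)
    (h : N.IsDershowitzMannaLT M) : multisetRank K m N < multisetRank K m M := by
  classical
  refine Finset.card_lt_card (Finset.ssubset_iff_of_subset (fun L hL => ?_) |>.2 ⟨N, ?_, ?_⟩)
  · simp only [Finset.mem_filter] at hL ⊢
    exact ⟨hL.1, hL.2.trans h⟩
  · simpa only [Finset.mem_filter] using ⟨hN, h⟩
  · simp only [Finset.mem_filter, not_and]
    exact fun _ hN =>
      (Multiset.wellFounded_isDershowitzMannaLT (α := ℕ)).irrefl.irrefl N hN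

end Rank

/-! ### Instances of right-hand sides -/

/-- The depths of the arguments at normal positions. -/
def SafeMapping.normalDepths (μ : SafeMapping S) (f : S.Sym) (a : Fin (S.ar f) → Term S V) :
    Multiset ℕ :=
  (μ.normalArgs f a).map Term.depth

/-- `f(a)` is a pattern, with `f` defined and equivalent to `f₀`, and `σ` maps the arguments of
the pattern to normal forms: the situation when an innermost step is about to contract the
instance of `f(a)` under `σ`. -/
structure IsInnermostRedex (P : Precedence S) (R : Set (Term S V × Term S V)) (f₀ f : S.Sym)
    (a : Fin (S.ar f) → Term S V) (σ : V → Term S V) : Prop where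
  eqv : P.eqv f₀ f
  isDefined : S.IsDefined f
  isValue : ∀ i, (a i).IsValue
  isNormalForm : ∀ i, IsNormalForm R ((a i).subst σ)

section Instances

variable {R : Set (Term S V × Term S V)} {P : Precedence S} {μ : SafeMapping S}
  {f₀ f g : S.Sym} {a : Fin (S.ar f) → Term S V} {b : Fin (S.ar g) → Term S V}
  {σ : V → Term S V}

theorem Precedence.gt_of_eqv_of_gt (h : P.eqv f₀ f) (h' : P.gt f g) : P.gt f₀ g :=
  ⟨P.trans _ _ _ h.1 h'.1, fun hg => h'.2 (P.trans _ _ _ hg h.1)⟩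

theorem BelowFun.arg {s : Term S V} (h : BelowFun P s (Term.app g b)) (j : Fin (S.ar g)) :
    BelowFun P s (b j) :=
  fun x hx => h x (Set.mem_insert_of_mem _ (Set.mem_iUnion.2 ⟨j, hx⟩))

/-- A term below the symbols of a pattern contains no recursive call: the only defined symbol of
the pattern is its root, and constructors are never above defined symbols. -/
theorem IsInnermostRedex.not_belowFun (hP : P.Admissible) (hr : IsInnermostRedex P R f₀ f a σ)
    (hfg : P.eqv f g) : ¬ BelowFun P (Term.app f a) (Term.app g b) := by
  intro h
  obtain ⟨x, hx, hxg⟩ := h g (Set.mem_insert _ _)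
  simp only [Term.syms, Set.mem_insert_iff, Set.mem_iUnion] at hx
  obtain rfl | ⟨i, hi⟩ := hx
  · exact hxg.2 hfg.2
  · exact hP.constructor_not_gt x g ((hr.isValue i).not_isDefined x hi)
      ((hP.defined_iff f g hfg).1 hr.isDefined) hxg

theorem AuxGt.cases_of_redex (h : PredicativeRecursivePS P μ R)
    (hr : IsInnermostRedex P R f₀ f a σ) {t : Term S V} (ht : AuxGt P μ (Term.app f a) t) :
    (IsNormalForm R (t.subst σ) ∧
      (t.subst σ).depth ≤ μ.maxNormalDepth f fun i => (a i).subst σ) ∨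
    ∃ (g : S.Sym) (b : Fin (S.ar g) → Term S V), t = Term.app g b ∧ P.gt f g ∧
      ∀ j, AuxGt P μ (Term.app f a) (b j) := by
  have hle := fun i hi =>
    μ.depth_le_maxNormalDepth (f := f) (a := fun i => (a i).subst σ) (i := i) hi
  cases ht with
  | st_eqv _ _ _ i hi hit =>
    exact .inl ((hit.subst_of_isValue h σ (hr.isValue i) (hr.isNormalForm i)).imp_right
      fun h => h.trans_le (hle i (hi hr.isDefined)))
  | st_gt _ _ _ i hi hit =>
    exact .inl ((hit.subst_of_isValue h σ (hr.isValue i) (hr.isNormalForm i)).imp_right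
      fun h => h.le.trans (hle i (hi hr.isDefined)))
  | ia _ g _ b _ hfg hj => exact .inr ⟨g, b, rfl, hfg, hj⟩

theorem IsInnermostRedex.subst_of_arg (h : PredicativeRecursivePS P μ R)
    (hr : IsInnermostRedex P R f₀ f a σ) {t : Term S V}
    (ht : ∃ i, GtPS P μ (a i) t ∨ SafeEqv P μ (a i) t) :
    IsNormalForm R (t.subst σ) ∧
      (t.subst σ).depth ≤ μ.maxNormalDepth f (fun i => (a i).subst σ) +
        μ.maxSafeDepth f (fun i => (a i).subst σ) := by
  have hle := μ.depth_arg_le (f := f) (a := fun i => (a i).subst σ)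
  obtain ⟨i, hi | hi⟩ := ht
  · exact (hi.subst_of_isValue h σ (hr.isValue i) (hr.isNormalForm i)).imp_right
      fun h => h.le.trans (hle i)
  · exact (hi.subst_of_isValue h σ (hr.isValue i) (hr.isNormalForm i)).imp_right
      fun h => h.trans_le (hle i)

/-- Depths turn the multiset comparison of the normal arguments in a recursive call into the
Dershowitz–Manna order on multisets of natural numbers. -/
theorem normalArgs_subst_of_gt (h : PredicativeRecursivePS P μ R)
    (hr : IsInnermostRedex P R f₀ f a σ)
    (hmul : MulExt (SafeEqv P μ) (GtPS P μ) (μ.normalArgs f a) (μ.normalArgs g b)) :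
    (∀ j, j ∉ μ.safe g → IsNormalForm R ((b j).subst σ)) ∧
      (μ.normalDepths g fun j => (b j).subst σ).IsDershowitzMannaLT
        (μ.normalDepths f fun i => (a i).subst σ) := by
  obtain ⟨X, Y, Z, W, hX, hM, hN, hZW, hXY⟩ := hmul
  have hval : ∀ s ∈ Z + X, s.IsValue ∧ IsNormalForm R (s.subst σ) := by
    intro s hs
    rw [← hM, SafeMapping.normalArgs, Multiset.mem_map] at hs
    obtain ⟨i, -, rfl⟩ := hs
    exact ⟨hr.isValue i, hr.isNormalForm i⟩
  have hY : ∀ y ∈ Y, IsNormalForm R (y.subst σ) ∧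
      ∃ x ∈ X, (y.subst σ).depth < (x.subst σ).depth := by
    intro y hy
    obtain ⟨x, hx, hxy⟩ := hXY y hy
    obtain ⟨hv, hn⟩ := hval x (Multiset.mem_add.2 (.inr hx))
    exact (hxy.subst_of_isValue h σ hv hn).imp_right fun h => ⟨x, hx, h⟩
  have hZW' : (∀ w ∈ W, IsNormalForm R (w.subst σ)) ∧
      W.map (fun t => (t.subst σ).depth) = Z.map fun t => (t.subst σ).depth := by
    have hZ : ∀ s ∈ Z, s.IsValue ∧ IsNormalForm R (s.subst σ) := fun s hs =>
      hval s (Multiset.mem_add.2 (.inl hs))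
    clear hM hN hval
    induction hZW with
    | zero => simp
    | cons hzw _ ih =>
      rename_i z w Z W _
      obtain ⟨hv, hn⟩ := hZ z (Multiset.mem_cons_self _ _)
      obtain ⟨h1, h2⟩ := hzw.subst_of_isValue h σ hv hn
      obtain ⟨h3, h4⟩ := ih fun s hs => hZ s (Multiset.mem_cons_of_mem hs)
      refine ⟨fun x hx => ?_, by simp [h2, h4]⟩
      obtain rfl | hx := Multiset.mem_cons.1 hx
      · exact h1
      · exact h3 x hx
  have hdepths : ∀ (k : S.Sym) (c : Fin (S.ar k) → Term S V),
      (μ.normalDepths k fun i => (c i).subst σ) =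
        (μ.normalArgs k c).map fun t => (t.subst σ).depth := fun k c => by
    simp [SafeMapping.normalDepths, SafeMapping.normalArgs]
  constructor
  · intro j hj
    have hmem : b j ∈ μ.normalArgs g b :=
      Multiset.mem_map.2 ⟨j, by simpa using hj, rfl⟩
    rw [hN, Multiset.mem_add] at hmem
    exact hmem.elim (hZW'.1 _) fun hy => (hY _ hy).1
  · refine ⟨Z.map fun t => (t.subst σ).depth, Y.map fun t => (t.subst σ).depth,
      X.map fun t => (t.subst σ).depth, by simpa using hX, ?_, ?_, ?_⟩
    · rw [hdepths, hN, Multiset.map_add, hZW'.2]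
    · rw [hdepths, hM, Multiset.map_add]
    · simp only [Multiset.mem_map]
      rintro _ ⟨y, hy, rfl⟩
      obtain ⟨x, hx, hxy⟩ := (hY y hy).2
      exact ⟨_, ⟨x, hx, rfl⟩, hxy⟩

variable {T Q : Polynomial ℕ}

/-- Terms below a redex in the auxiliary order evaluate to normal forms whose depth depends on the
normal arguments of the redex only. -/
theorem exists_bound_of_auxGt (h : PredicativeRecursivePS P μ R)
    (hlow : ∀ g, P.gt f₀ g → SymbolBound R μ T Q g) (t : Term S V) :
    ∃ p q : Polynomial ℕ, ∀ f a σ, IsInnermostRedex P R f₀ f a σ → AuxGt P μ (Term.app f a) t →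
      EvaluatesWithin R (p.eval (μ.maxNormalDepth f fun i => (a i).subst σ))
        (fun s => s.depth ≤ q.eval (μ.maxNormalDepth f fun i => (a i).subst σ))
        (t.subst σ) := by
  induction t with
  | var x =>
    refine ⟨0, Polynomial.X, fun f a σ hr ht => ?_⟩
    obtain ⟨hnf, hd⟩ | ⟨_, _, h', _⟩ := ht.cases_of_redex h hr
    · exact .of_isNormalForm hnf (by simpa using hd)
    · cases h'
  | app g b ih =>
    choose p q hpq using ih
    refine ⟨∑ j, p j + T.comp (∑ j, q j), Polynomial.X + (Q.comp (∑ j, q j) + ∑ j, q j),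
      fun f a σ hr ht => ?_⟩
    obtain ⟨hnf, hd⟩ | ⟨_, _, h', hfg, hj⟩ := ht.cases_of_redex h hr
    · refine .of_isNormalForm hnf (hd.trans ?_)
      simp
    · cases h'
      have harg : ∀ j, EvaluatesWithin R ((p j).eval (μ.maxNormalDepth f fun i => (a i).subst σ))
          (fun s => s.depth ≤ ∑ j, (q j).eval (μ.maxNormalDepth f fun i => (a i).subst σ))
          ((b j).subst σ) := fun j =>
        (hpq j f a σ hr (hj j)).mono le_rfl fun s hs => hs.trans
          (Finset.single_le_sum (f := fun j => (q j).eval _) (fun _ _ => Nat.zero_le _)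
            (Finset.mem_univ j))
      refine ((hlow g (P.gt_of_eqv_of_gt hr.eqv hfg)).evaluatesWithin_app
        (fun j _ => harg j) (fun j _ => harg j)).mono ?_ fun s hs => ?_
      · simp [Polynomial.eval_finsetSum]
      · simp only [Polynomial.eval_add, Polynomial.eval_comp, Polynomial.eval_finsetSum,
          Polynomial.eval_X]
        omega

/-- Terms without recursive calls: the depth of the safe arguments of the redex enters the depth
of the results only additively. -/
theorem exists_bound_of_belowFun (h : PredicativeRecursivePS P μ R)
    (hlow : ∀ g, P.gt f₀ g → SymbolBound R μ T Q g) (t : Term S V) :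
    ∃ p q : Polynomial ℕ, ∀ f a σ, IsInnermostRedex P R f₀ f a σ → GtPS P μ (Term.app f a) t →
      BelowFun P (Term.app f a) t →
      EvaluatesWithin R (p.eval (μ.maxNormalDepth f fun i => (a i).subst σ))
        (fun s => s.depth ≤ q.eval (μ.maxNormalDepth f fun i => (a i).subst σ) +
          μ.maxSafeDepth f fun i => (a i).subst σ)
        (t.subst σ) := by
  induction t with
  | var x =>
    refine ⟨0, Polynomial.X, fun f a σ hr ht _ => ?_⟩
    obtain ht | ⟨_, _, _, h', _⟩ | ⟨_, _, _, h', _⟩ := (gtPS_iff P μ f a _).1 ht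
    · obtain ⟨hnf, hd⟩ := hr.subst_of_arg h ht
      exact .of_isNormalForm hnf (by simpa using hd)
    · cases h'
    · cases h'
  | app g b ih =>
    choose p q hpq using ih
    choose p' q' hpq' using fun j => exists_bound_of_auxGt h hlow (b j)
    refine ⟨∑ j, (p j + p' j) + T.comp (∑ j, q' j),
      Polynomial.X + (Q.comp (∑ j, q' j) + ∑ j, q j), fun f a σ hr ht hb => ?_⟩
    set m := μ.maxNormalDepth f fun i => (a i).subst σ
    obtain ht | ⟨_, _, _, h', hfg, hnormal, hsafe, -⟩ | ⟨_, _, _, h', hfg, -⟩ :=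
      (gtPS_iff P μ f a _).1 ht
    · obtain ⟨hnf, hd⟩ := hr.subst_of_arg h ht
      refine .of_isNormalForm hnf (hd.trans ?_)
      simp only [Polynomial.eval_add, Polynomial.eval_X]
      omega
    · cases h'
      refine ((hlow g (P.gt_of_eqv_of_gt hr.eqv hfg)).evaluatesWithin_app
        (n := fun j => (p j).eval m + (p' j).eval m) (A := ∑ j, (q' j).eval m)
        (B := ∑ j, (q j).eval m + μ.maxSafeDepth f fun i => (a i).subst σ)
        (fun j hj => ?_) (fun j hj => ?_)).mono ?_ fun s hs => ?_
      · exact (hpq' j f a σ hr (hnormal j hj)).mono (Nat.le_add_left _ _) fun s hs => hs.trans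
          (Finset.single_le_sum (f := fun j => (q' j).eval m) (fun _ _ => Nat.zero_le _)
            (Finset.mem_univ j))
      · exact (hpq j f a σ hr (hsafe j hj) (hb.arg j)).mono (Nat.le_add_right _ _)
          fun s hs => hs.trans (Nat.add_le_add_right
            (Finset.single_le_sum (f := fun j => (q j).eval m) (fun _ _ => Nat.zero_le _)
              (Finset.mem_univ j)) _)
      · simp [Polynomial.eval_finsetSum]
      · simp only [Polynomial.eval_add, Polynomial.eval_comp, Polynomial.eval_finsetSum,
          Polynomial.eval_X]
        omega
    · cases h'
      exact absurd hb (hr.not_belowFun h.admissible hfg)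

/-- Terms below a redex contain at most one recursive call. So a bound `N`, `E` for the recursive
calls on smaller normal arguments enters the bound for the term additively, with factor one. -/
theorem exists_bound_of_gtPS (h : PredicativeRecursivePS P μ R)
    (hlow : ∀ g, P.gt f₀ g → SymbolBound R μ T Q g) (t : Term S V) :
    ∃ p q : Polynomial ℕ, ∀ f a σ, IsInnermostRedex P R f₀ f a σ → ∀ N E : ℕ,
      (∀ g (c : Fin (S.ar g) → Term S V), P.eqv f₀ g → (∀ i, IsNormalForm R (c i)) →
        (μ.normalDepths g c).IsDershowitzMannaLT (μ.normalDepths f fun i => (a i).subst σ) →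
        EvaluatesWithin R N (fun s => s.depth ≤ E + μ.maxSafeDepth g c) (Term.app g c)) →
      GtPS P μ (Term.app f a) t →
      EvaluatesWithin R (p.eval (μ.maxNormalDepth f fun i => (a i).subst σ) + N)
        (fun s => s.depth ≤ q.eval (μ.maxNormalDepth f fun i => (a i).subst σ) + E +
          μ.maxSafeDepth f fun i => (a i).subst σ)
        (t.subst σ) := by
  classical
  induction t with
  | var x =>
    refine ⟨0, Polynomial.X, fun f a σ hr N E _ ht => ?_⟩
    obtain ht | ⟨_, _, _, h', _⟩ | ⟨_, _, _, h', _⟩ := (gtPS_iff P μ f a _).1 ht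
    · obtain ⟨hnf, hd⟩ := hr.subst_of_arg h ht
      refine .of_isNormalForm hnf (hd.trans ?_)
      simp only [Polynomial.eval_X]
      omega
    · cases h'
    · cases h'
  | app g b ih =>
    choose p q hpq using ih
    choose p' q' hpq' using fun j => exists_bound_of_auxGt h hlow (b j)
    choose p'' q'' hpq'' using fun j => exists_bound_of_belowFun h hlow (b j)
    refine ⟨∑ j, (p j + p' j + p'' j) + T.comp (∑ j, q' j),
      Polynomial.X + (Q.comp (∑ j, q' j) + ∑ j, (q j + q'' j)), fun f a σ hr N E hrec ht => ?_⟩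
    replace hpq := fun j => hpq j f a σ hr N E hrec
    replace hpq' := fun j => hpq' j f a σ hr
    replace hpq'' := fun j => hpq'' j f a σ hr
    set m := μ.maxNormalDepth f fun i => (a i).subst σ
    set d := μ.maxSafeDepth f fun i => (a i).subst σ
    have hq' : ∀ j, (q' j).eval m ≤ ∑ j, (q' j).eval m := fun j =>
      Finset.single_le_sum (f := fun j => (q' j).eval m) (fun _ _ => Nat.zero_le _)
        (Finset.mem_univ j)
    have hq : ∀ j, (q j).eval m + (q'' j).eval m ≤ ∑ j, ((q j).eval m + (q'' j).eval m) := fun j =>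
      Finset.single_le_sum (f := fun j => (q j).eval m + (q'' j).eval m)
        (fun _ _ => Nat.zero_le _) (Finset.mem_univ j)
    obtain ht | ⟨_, _, _, h', hfg, hnormal, hsafe, hone⟩ | ⟨_, _, _, h', hfg, hmul, hsafe⟩ :=
      (gtPS_iff P μ f a _).1 ht
    · obtain ⟨hnf, hd⟩ := hr.subst_of_arg h ht
      refine .of_isNormalForm hnf (hd.trans ?_)
      simp only [Polynomial.eval_add, Polynomial.eval_X]
      omega
    · cases h'
      refine ((hlow g (P.gt_of_eqv_of_gt hr.eqv hfg)).evaluatesWithin_app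
        (n := fun j => (p j).eval m + (p' j).eval m + (p'' j).eval m +
          if j ∈ μ.safe g ∧ ¬ BelowFun P (Term.app f a) (b j) then N else 0)
        (A := ∑ j, (q' j).eval m)
        (B := ∑ j, ((q j).eval m + (q'' j).eval m) + E + d)
        (fun j hj => ?_) (fun j hj => ?_)).mono ?_ fun s hs => ?_
      · exact (hpq' j (hnormal j hj)).mono (by omega) fun s hs => hs.trans (hq' j)
      · have := hq j
        by_cases hb : BelowFun P (Term.app f a) (b j)
        · exact (hpq'' j (hsafe j hj) hb).mono (by omega) fun s hs => by omega
        · refine (hpq j (hsafe j hj)).mono ?_ fun s hs => by omega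
          rw [if_pos ⟨hj, hb⟩]
          omega
      · -- only one argument contributes the bound `N` for the recursive call
        have hN : (∑ j, if j ∈ μ.safe g ∧ ¬ BelowFun P (Term.app f a) (b j) then N else 0) ≤ N := by
          rw [← Finset.sum_filter, Finset.sum_const, smul_eq_mul]
          refine (Nat.mul_le_mul_right N (Finset.card_le_one.2 ?_)).trans_eq (one_mul N)
          intro j hj k hk
          simp only [Finset.mem_filter, Finset.mem_univ, true_and] at hj hk
          exact hone j k hj.1 hk.1 hj.2 hk.2
        simp only [Polynomial.eval_add, Polynomial.eval_comp, Polynomial.eval_finsetSum,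
          Finset.sum_add_distrib] at hN ⊢
        omega
      · simp only [Polynomial.eval_add, Polynomial.eval_comp, Polynomial.eval_finsetSum,
          Polynomial.eval_X]
        omega
    · cases h'
      obtain ⟨hnf, hlt⟩ := normalArgs_subst_of_gt h hr hmul
      -- the normal arguments are normal forms already, so that the evaluation of the safe ones
      -- leaves the multiset of their depths unchanged
      refine (EvaluatesWithin.app (N := N)
        (ψ := fun s => s.depth ≤ E + (∑ j, ((q j).eval m + (q'' j).eval m) + d))
        (n := fun j => (p'' j).eval m)
        (φ := fun j s => if j ∈ μ.safe g then
          s.depth ≤ ∑ j, ((q j).eval m + (q'' j).eval m) + d else s = (b j).subst σ)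
        (fun c hc hφ => ?_) fun j => ?_).mono ?_ fun s hs => ?_
      · have hdepths : μ.normalDepths g c = μ.normalDepths g fun j => (b j).subst σ := by
          unfold SafeMapping.normalDepths SafeMapping.normalArgs
          congr 1
          refine Multiset.map_congr rfl fun j hj => ?_
          have := hφ j
          rwa [if_neg (by simpa using hj)] at this
        refine (hrec g c ⟨P.trans _ _ _ hr.eqv.1 hfg.1, P.trans _ _ _ hfg.2 hr.eqv.2⟩ hc
          (hdepths ▸ hlt)).mono le_rfl fun s hs => hs.trans (Nat.add_le_add_left ?_ E)
        refine μ.maxSafeDepth_le fun j hj => ?_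
        have := hφ j
        rwa [if_pos hj] at this
      · by_cases hj : j ∈ μ.safe g
        · have := hq j
          simp only [if_pos hj]
          exact (hpq'' j (hsafe j hj).1 (hsafe j hj).2).mono le_rfl fun s hs => by omega
        · simp only [if_neg hj]
          exact .of_isNormalForm (hnf j hj) rfl
      · simp only [Polynomial.eval_add, Polynomial.eval_comp, Polynomial.eval_finsetSum,
          Finset.sum_add_distrib]
        omega
      · simp only [Polynomial.eval_add, Polynomial.eval_comp, Polynomial.eval_finsetSum,
          Polynomial.eval_X]
        omega

end Instances

/-! ### Bounds for the defined symbols -/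

section Symbols

variable {R : Set (Term S V × Term S V)} {P : Precedence S} {μ : SafeMapping S}

theorem SymbolBound.mono {T T' Q Q' : Polynomial ℕ} {g : S.Sym} (h : SymbolBound R μ T Q g)
    (hT : ∀ m, T.eval m ≤ T'.eval m) (hQ : ∀ m, Q.eval m ≤ Q'.eval m) :
    SymbolBound R μ T' Q' g :=
  fun c hc => (h c hc).mono (hT _) fun _ hs => hs.trans (Nat.add_le_add_right (hQ _) _)

theorem card_normalDepths_le (μ : SafeMapping S) (f : S.Sym) (a : Fin (S.ar f) → Term S V) :
    (μ.normalDepths f a).card ≤ S.ar f := by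
  have := Finset.card_filter_le (Finset.univ : Finset (Fin (S.ar f))) fun i => i ∉ μ.safe f
  rw [SafeMapping.normalDepths, SafeMapping.normalArgs, Multiset.card_map, Multiset.card_map]
  exact this.trans_eq (Finset.card_fin _)

theorem mem_normalDepths {f : S.Sym} {a : Fin (S.ar f) → Term S V} {x : ℕ} :
    x ∈ μ.normalDepths f a ↔ ∃ i, i ∉ μ.safe f ∧ (a i).depth = x := by
  simp [SafeMapping.normalDepths, SafeMapping.normalArgs]

theorem maxNormalDepth_le_of_isDershowitzMannaLT {f g : S.Sym} {a : Fin (S.ar f) → Term S V}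
    {c : Fin (S.ar g) → Term S V}
    (h : (μ.normalDepths g c).IsDershowitzMannaLT (μ.normalDepths f a)) :
    μ.maxNormalDepth g c ≤ μ.maxNormalDepth f a := by
  obtain ⟨X, Y, Z, -, hY, hZ, hlt⟩ := h
  have hle : ∀ x ∈ X + Z, x ≤ μ.maxNormalDepth f a := by
    intro x hx
    rw [← hZ, mem_normalDepths] at hx
    obtain ⟨i, hi, rfl⟩ := hx
    exact μ.depth_le_maxNormalDepth hi
  refine μ.maxNormalDepth_le fun j hj => ?_
  have hmem : (c j).depth ∈ X + Y := hY ▸ mem_normalDepths.2 ⟨j, hj, rfl⟩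
  obtain hx | hy := Multiset.mem_add.1 hmem
  · exact hle _ (Multiset.mem_add.2 (.inl hx))
  · obtain ⟨z, hz, hyz⟩ := hlt _ hy
    exact hyz.le.trans (hle _ (Multiset.mem_add.2 (.inr hz)))

/-- The recursion from a class of equivalent symbols to the class itself: the number of nested
recursive calls is bounded by the rank of the multiset of the depths of the normal arguments, and
each of them adds a polynomial. -/
theorem exists_symbolBound_of_lower [Finite S.Sym] (hR : R.Finite)
    (h : PredicativeRecursivePS P μ R) {f₀ : S.Sym} {T Q : Polynomial ℕ}
    (hlow : ∀ g, P.gt f₀ g → SymbolBound R μ T Q g) :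
    ∃ T' Q' : Polynomial ℕ, ∀ f, P.eqv f₀ f → SymbolBound R μ T' Q' f := by
  have := Fintype.ofFinite S.Sym
  choose p q hpq using exists_bound_of_gtPS h hlow
  set pR : Polynomial ℕ := ∑ x ∈ hR.toFinset, p x.2 with hpR
  set qR : Polynomial ℕ := ∑ x ∈ hR.toFinset, q x.2 with hqR
  set K := Finset.univ.sup S.ar
  have hpr : ∀ l r, (l, r) ∈ R → ∀ m, (p r).eval m ≤ pR.eval m := fun l r hlr m => by
    rw [hpR, Polynomial.eval_finsetSum]
    exact Finset.single_le_sum (f := fun x : Term S V × Term S V => (p x.2).eval m)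
      (fun _ _ => Nat.zero_le _) (hR.mem_toFinset.2 hlr)
  have hqr : ∀ l r, (l, r) ∈ R → ∀ m, (q r).eval m ≤ qR.eval m := fun l r hlr m => by
    rw [hqR, Polynomial.eval_finsetSum]
    exact Finset.single_le_sum (f := fun x : Term S V × Term S V => (q x.2).eval m)
      (fun _ _ => Nat.zero_le _) (hR.mem_toFinset.2 hlr)
  have key : ∀ m n f (c : Fin (S.ar f) → Term S V), P.eqv f₀ f → (∀ i, IsNormalForm R (c i)) →
      μ.maxNormalDepth f c ≤ m → multisetRank K m (μ.normalDepths f c) < n →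
      EvaluatesWithin R (n * (pR.eval m + 1))
        (fun s => s.depth ≤ n * (qR.eval m + m + 1) + μ.maxSafeDepth f c) (Term.app f c) := by
    intro m n
    induction n with
    | zero => intro _ _ _ _ _ h; exact absurd h (Nat.not_lt_zero _)
    | succ n ih =>
      intro f c hf hc hm hrank
      refine evaluatesWithin_iff.2 ⟨fun _ => ?_, fun t' ht => ?_⟩
      · refine μ.depth_app_le.trans ?_
        rw [Nat.succ_mul]
        omega
      generalize hs : Term.app f c = s at ht
      cases ht with
      | ctx f' c' i hi =>
        cases hs
        exact absurd hi.step (hc i _)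
      | root hlr σ f' c' hl _ =>
        cases hs
        rename_i r _
        obtain ⟨f', a, rfl, hdef, hval⟩ := h.exists_lhs hlr
        simp only [Term.subst] at hl
        cases hl
        have hpm : _ ≤ pR.eval m := (hpr _ r hlr _).trans (monotone_polynomial_eval pR hm)
        have hqm : _ ≤ qR.eval m := (hqr _ r hlr _).trans (monotone_polynomial_eval qR hm)
        -- the rule adds a polynomial to the bound for the recursive calls, which have lower rank
        refine ⟨_, ?_, (hpq r f a σ ⟨hf, hdef, hval, hc⟩ (n * (pR.eval m + 1))
          (n * (qR.eval m + m + 1)) (fun g c hg hc hlt => ?_)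
          (h.compatible _ r hlr)).mono le_rfl fun s hs => ?_⟩
        · rw [Nat.succ_mul]
          omega
        · have hm' := (maxNormalDepth_le_of_isDershowitzMannaLT hlt).trans hm
          have hmem : μ.normalDepths g c ∈ boundedMultisets K m := by
            refine mem_boundedMultisets ((card_normalDepths_le μ g c).trans
              (Finset.le_sup (f := S.ar) (Finset.mem_univ g))) fun x hx => ?_
            obtain ⟨i, hi, rfl⟩ := mem_normalDepths.1 hx
            exact (μ.depth_le_maxNormalDepth hi).trans hm'
          refine ih g c hg hc hm' ?_
          have := multisetRank_lt hmem hlt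
          omega
        · rw [Nat.succ_mul]
          omega
  set B : Polynomial ℕ := ∑ k ∈ Finset.range (K + 1), (Polynomial.X + 1) ^ k with hB
  classical
  refine ⟨(B + 1) * (pR + 1), (B + 1) * (qR + Polynomial.X + 1), fun f hf c hc => ?_⟩
  have hrank : multisetRank K (μ.maxNormalDepth f c) (μ.normalDepths f c) <
      (B + 1).eval (μ.maxNormalDepth f c) := by
    refine Nat.lt_of_le_of_lt ((Finset.card_filter_le _ _).trans
      (card_boundedMultisets_le K _)) ?_
    simp [hB, Polynomial.eval_finsetSum]
  simpa using key _ _ f c hf hc le_rfl hrank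

theorem exists_symbolBound [Finite S.Sym] (hR : R.Finite)
    (h : PredicativeRecursivePS P μ R) (f : S.Sym) :
    ∃ T Q : Polynomial ℕ, SymbolBound R μ T Q f := by
  have := Fintype.ofFinite S.Sym
  have : Std.Irrefl fun g f => P.gt f g := ⟨fun f hf => hf.2 hf.1⟩
  have : IsTrans S.Sym fun g f => P.gt f g :=
    ⟨fun a b c hab hbc => ⟨P.trans _ _ _ hbc.1 hab.1, fun hac => hab.2 (P.trans _ _ _ hac hbc.1)⟩⟩
  have hwf : WellFounded fun g f => P.gt f g := Finite.wellFounded_of_trans_of_irrefl _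
  induction f using hwf.induction with
  | _ f ih =>
    classical
    choose! T Q hTQ using ih
    have hle : ∀ (p : S.Sym → Polynomial ℕ) (g : S.Sym) (m : ℕ),
        (p g).eval m ≤ (∑ g, p g).eval m := fun p g m => by
      rw [Polynomial.eval_finsetSum]
      exact Finset.single_le_sum (f := fun g => (p g).eval m) (fun _ _ => Nat.zero_le _)
        (Finset.mem_univ g)
    obtain ⟨T', Q', h'⟩ := exists_symbolBound_of_lower hR h (f₀ := f)
      fun g hg => (hTQ g hg).mono (hle T g) (hle Q g)
    exact ⟨T', Q', h' f ⟨P.refl f, P.refl f⟩⟩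

end Symbols

instance [Finite S.Sym] : Finite (Precedence S) :=
  Finite.of_injective Precedence.ge fun P P' h => by
    cases P; cases P'; cases h; rfl

instance [Finite S.Sym] : Finite (SafeMapping S) :=
  Finite.of_injective SafeMapping.safe fun μ μ' h => by
    cases μ; cases μ'; cases h; rfl

end POPStarPS

theorem mainTheorem5 (S : POPStarPS.Signature) [Finite S.Sym] (V : Type*)
    (R : Set (POPStarPS.Term S V × POPStarPS.Term S V)) (hR : R.Finite) :
    ∃ p : Polynomial ℕ,
      ∀ (P : POPStarPS.Precedence S) (μ : POPStarPS.SafeMapping S),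
        POPStarPS.PredicativeRecursivePS P μ R →
        ∀ (f : S.Sym) (a : Fin (S.ar f) → POPStarPS.Term S V),
          S.IsDefined f → (∀ i, (a i).IsValue) →
          POPStarPS.derivationHeight R (POPStarPS.Term.app f a) ≤
            ((p.eval (μ.maxNormalDepth f a) : ℕ) : ℕ∞) := by
  have := Fintype.ofFinite (POPStarPS.Precedence S × POPStarPS.SafeMapping S × S.Sym)
  have hex : ∀ x : POPStarPS.Precedence S × POPStarPS.SafeMapping S × S.Sym,
      ∃ T : Polynomial ℕ, POPStarPS.PredicativeRecursivePS x.1 x.2.1 R →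
        ∃ Q : Polynomial ℕ, POPStarPS.SymbolBound R x.2.1 T Q x.2.2 := by
    intro x
    by_cases h : POPStarPS.PredicativeRecursivePS x.1 x.2.1 R
    · obtain ⟨T, hT⟩ := POPStarPS.exists_symbolBound hR h x.2.2
      exact ⟨T, fun _ => hT⟩
    · exact ⟨0, fun h' => absurd h' h⟩
  choose T hT using hex
  refine ⟨∑ x, T x, fun P μ h f a _ ha => sSup_le ?_⟩
  rintro _ ⟨k, t, hk, rfl⟩
  obtain ⟨Q, hQ⟩ := hT (P, μ, f) h
  have hle := (hQ a (fun i => h.isNormalForm_of_isValue (ha i)) k t hk).1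
  rw [Polynomial.eval_finsetSum]
  exact Nat.cast_le.2 (hle.trans (Finset.single_le_sum (f := fun x => (T x).eval _)
    (fun _ _ => Nat.zero_le _) (Finset.mem_univ (P, μ, f))))
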